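/- Requests are generated at rate $\lambda>0$ and are processed either on a device or at a dedicated edge server. The following model is used. Every station is a single-server first-come-first-served queue that is empty at time $0$ and has Poisson arrivals; its service times are i.i.d. and independent of the arrivals. No assumption is made on the joint law of different stations. The accelerator of the device (of the edge), with parallelism level $k_{dev}>0$ ($k_{edge}>0$) and service rate $\mu^{proc}_{dev}$ ($\mu^{proc}_{edge}$) per unit of parallelism, is modelled by the M/D/1 approximation of an M/D/$k$ queue with aggregated service rate: arrival rate $\lambda$ and deterministic service times $1/(k_{dev}\mu^{proc}_{dev})$ (respectively $1/(k_{edge}\mu^{proc}_{edge})$). The network interface (NIC) of the device is an M/M/1 queue with arrival rate $\lambda$ and service rate $\mu^{net}_{dev}$. The NIC of the edge is an M/M/1 queue with service rate $\mu^{net}_{edge}$ whose arrival rate $\lambda^{net}_{edge}$ is the throughput (almost sure long-run completion rate) of the edge accelerator queue. All queues are stable: $\lambda<k_{dev}\mu^{proc}_{dev}$, $\lambda<\mu^{net}_{dev}$, $\lambda<k_{edge}\mu^{proc}_{edge}$, $\lambda^{net}_{edge}<\mu^{net}_{edge}$. Let $s_{dev},s_{edge}>0$ be the service times of a request on the two accelerators,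 $D_{req},D_{res}\ge 0$ the payload sizes of request and result, and $B>0$ the bandwidth. The end-to-end latency of the $n$-th request is $$T_{dev}(n)=w^{proc}_{dev}(n)+s_{dev},\qquad T_{edge}(n)=w^{net}_{dev}(n)+\frac{D_{req}}{B}+w^{proc}_{edge}(n)+s_{edge}+w^{net}_{edge}(n)+\frac{D_{res}}{B},$$ where $w(n)$ is the time that the $n$-th request waits in the respective queue before its service begins. Then the steady-state mean latencies $\overline T_{dev}=\lim_n\mathbb E[T_{dev}(n)]$ and $\overline T_{edge}=\lim_n\mathbb E[T_{edge}(n)]$ exist and are finite, and edge offloading has the higher mean latency, $\overline T_{dev}<\overline T_{edge}$, if and only if $$s_{dev}-s_{edge}<\frac{\lambda}{\mu^{net}_{dev}(\mu^{net}_{dev}-\lambda)}+\frac{\lambda}{\mu^{net}_{edge}(\mu^{net}_{edge}-\lambda)}+\frac{D_{req}+D_{res}}{B}+\frac12\left(\frac1{k_{edge}\mu^{proc}_{edge}-\lambda}-\frac1{k_{edge}\mu^{proc}_{edge}}\right)-\frac12\left(\frac1{k_{dev}\mu^{proc}_{dev}-\lambda}-\frac1{k_{dev}\mu^{proc}_{dev}}\right).$$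 -/

import Mathlib

open MeasureTheory ProbabilityTheory Filter Topology

/-- The random input of a single-server queue that is empty at time `0`: the time
`interarrival n` between the arrivals of requests `n - 1` and `n` (for `n = 0`: between time `0`
and the first arrival), and the service time `service n` of request `n`. -/
structure Queue (Ω : Type*) where
  interarrival : ℕ → Ω → ℝ
  service : ℕ → Ω → ℝ

namespace Queue

variable {Ω : Type*}

/-- Arrival epoch of request `n`. -/
def arrival (Q : Queue Ω) (n : ℕ) (ω : Ω) : ℝ :=
  ∑ i ∈ Finset.range (n + 1), Q.interarrival i ω

/-- Epoch at which request `n` leaves the server under first-come-first-served service: its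
service begins as soon as it has arrived and request `n - 1` has left. -/
noncomputable def departure (Q : Queue Ω) : ℕ → Ω → ℝ
  | 0, ω => Q.arrival 0 ω + Q.service 0 ω
  | n + 1, ω => max (Q.arrival (n + 1) ω) (Q.departure n ω) + Q.service (n + 1) ω

/-- Time that request `n` spends waiting in the queue before its service begins. -/
noncomputable def wait (Q : Queue Ω) (n : ℕ) (ω : Ω) : ℝ :=
  Q.departure n ω - Q.service n ω - Q.arrival n ω

variable [MeasurableSpace Ω]

/-- `M/G/1/FCFS`: Poisson arrivals with rate `rate` (independent, exponentially distributed
interarrival times), independent service times with law `ν`, one server. -/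
structure IsMG1 (Q : Queue Ω) (P : Measure Ω) (rate : ℝ) (ν : Measure ℝ) : Prop where
  interarrival_law : ∀ n, HasLaw (Q.interarrival n) (expMeasure rate) P
  service_law : ∀ n, HasLaw (Q.service n) ν P
  indep : iIndepFun (Sum.elim Q.interarrival Q.service) P

/-- `M/M/1/FCFS` with arrival rate `rate` and service rate `μ`. -/
def IsMM1 (Q : Queue Ω) (P : Measure Ω) (rate μ : ℝ) : Prop :=
  Q.IsMG1 P rate (expMeasure μ)

/-- `M/D/1/FCFS` with arrival rate `rate` and service rate `μ`, that is, with deterministic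
service times `1 / μ`. -/
def IsMD1 (Q : Queue Ω) (P : Measure Ω) (rate μ : ℝ) : Prop :=
  Q.IsMG1 P rate (Measure.dirac (1 / μ))

/-- An accelerator with degree of parallelism `k` and service rate `μ` per unit of parallelism,
in the single-server approximation of `M/D/k/FCFS` that aggregates the service rate to `k * μ`. -/
def IsAccelerator (Q : Queue Ω) (P : Measure Ω) (rate k μ : ℝ) : Prop :=
  Q.IsMD1 P rate (k * μ)

/-- The throughput (completion rate) of the queue is `θ`: almost surely, the number of completed
requests divided by the elapsed time tends to `θ` along the completion epochs. -/
def HasThroughput (Q : Queue Ω) (P : Measure Ω) (θ : ℝ) : Prop :=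
  ∀ᵐ ω ∂P, Tendsto (fun n : ℕ => ((n : ℝ) + 1) / Q.departure n ω) atTop (𝓝 θ)

end Queue

/-- The steady-state mean of a per-request quantity `X n` (`n` the index of the request) is `m`:
every `X n` is integrable, and the expectation of `X n` tends to `m`. -/
def HasSteadyStateMean {Ω : Type*} [MeasurableSpace Ω] (P : Measure Ω) (X : ℕ → Ω → ℝ)
    (m : ℝ) : Prop :=
  (∀ n, Integrable (X n) P) ∧ Tendsto (fun n => ∫ ω, X n ω ∂P) atTop (𝓝 m)

/-- End-to-end latency of request `n` under on-device processing: the wait at the device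
accelerator, then the service time `sDev`. -/
noncomputable def deviceLatency {Ω : Type*} (procDev : Queue Ω) (sDev : ℝ) (n : ℕ) (ω : Ω) : ℝ :=
  procDev.wait n ω + sDev

/-- End-to-end latency of request `n` under edge offloading: the wait at the device NIC, the
transmission of the request (size `Dreq`, bandwidth `B`), the wait at the edge accelerator, the
service time `sEdge`, the wait at the edge NIC, and the transmission of the result
(size `Dres`). -/
noncomputable def edgeLatency {Ω : Type*} (netDev procEdge netEdge : Queue Ω)
    (sEdge Dreq Dres B : ℝ) (n : ℕ) (ω : Ω) : ℝ :=
  netDev.wait n ω + Dreq / B + procEdge.wait n ω + sEdge + netEdge.wait n ω + Dres / B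

/-! The mean latencies are sums of mean waits and constants, so linearity of expectation suffices
and the joint law of the stations plays no role. What remains is the mean wait of one M/G/1 queue
and the throughput of the edge accelerator.

Let `W n` be the wait, `V = W n + S`, and let `X` be exponential with rate `r`; by Lindley, `W (n +
1) = (V - X)⁺`. Integration by parts gives `E W(n+1)^(k+1) = E V^(k+1) - (k+1)/r * E W(n+1)^k`. For
`k = 1` the limit of this relation is Pollaczek–Khinchine, provided that the first two moments
converge. They increase with `n`, since the wait is stochastically increasing from `0`. Growth of
the second moment bounds the first, and growth of the third (`k = 2`) bounds the second
(`tendsto_of_moment_recursion`).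

For the throughput, the strong law gives arrival epochs asymptotic to `n / r`, and departures of a
stable queue with constant service keep the same slope. Hence the edge NIC also receives rate `lam`.
-/

/-! ### Moments and truncated moments of the exponential law. -/

section Exponential

open Set

variable {r : ℝ}

lemma expMeasure_eq_withDensity (r : ℝ) :
    expMeasure r = (volume.restrict (Ici 0)).withDensity
      (fun x => ENNReal.ofReal (r * Real.exp (-(r * x)))) := by
  have h : gammaPDF 1 r =
      (Ici (0 : ℝ)).indicator (fun x => ENNReal.ofReal (r * Real.exp (-(r * x)))) := by
    funext x
    by_cases hx : 0 ≤ x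
    · rw [indicator_of_mem (mem_Ici.2 hx)]
      exact exponentialPDF_of_nonneg hx
    · rw [indicator_of_notMem (by simpa using hx)]
      exact gammaPDF_of_neg (a := 1) (r := r) (not_le.1 hx)
  rw [expMeasure, gammaMeasure, h, withDensity_indicator measurableSet_Ici]

lemma integral_expMeasure (hr : 0 < r) (f : ℝ → ℝ) :
    ∫ x, f x ∂expMeasure r = ∫ x in Ioi 0, r * Real.exp (-(r * x)) * f x := by
  rw [expMeasure_eq_withDensity, integral_withDensity_eq_integral_toReal_smul (by fun_prop)
    (by simp), integral_Ici_eq_integral_Ioi]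
  refine integral_congr_ae (ae_of_all _ fun x => ?_)
  simp only [smul_eq_mul]
  rw [ENNReal.toReal_ofReal (by positivity)]

lemma ae_nonneg_expMeasure (r : ℝ) : ∀ᵐ x ∂expMeasure r, 0 ≤ x := by
  rw [expMeasure_eq_withDensity]
  exact (withDensity_absolutelyContinuous _ _).ae_le
    ((ae_restrict_iff' measurableSet_Ici).2 (ae_of_all _ fun x hx => hx))

lemma integrable_pow_expMeasure (hr : 0 < r) (n : ℕ) :
    Integrable (fun x => x ^ n) (expMeasure r) := by
  rw [expMeasure_eq_withDensity, integrable_withDensity_iff_integrable_smul' (by fun_prop)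
    (by simp), ← IntegrableOn, integrableOn_Ici_iff_integrableOn_Ioi]
  have h := (integrableOn_rpow_mul_exp_neg_mul_rpow (p := 1) (s := n) (b := r)
    (by linarith [n.cast_nonneg (α := ℝ)]) one_pos hr).const_mul r
  refine IntegrableOn.congr_fun (s := Ioi 0) h (fun x hx => ?_) measurableSet_Ioi
  simp only [smul_eq_mul, Real.rpow_natCast, Real.rpow_one]
  rw [ENNReal.toReal_ofReal (by positivity), neg_mul]
  ring

lemma memLp_id_expMeasure (hr : 0 < r) (n : ℕ) (hn : n ≠ 0) :
    MemLp id n (expMeasure r) := by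
  rw [← integrable_norm_rpow_iff aestronglyMeasurable_id (by simpa using hn) (by simp)]
  refine (integrable_pow_expMeasure hr n).congr ?_
  filter_upwards [ae_nonneg_expMeasure r] with x hx
  simp [abs_of_nonneg hx]

lemma integral_pow_expMeasure (hr : 0 < r) (n : ℕ) :
    ∫ x, x ^ n ∂expMeasure r = n.factorial / r ^ n := by
  have h := Real.integral_rpow_mul_exp_neg_mul_Ioi (a := n + 1) (r := r) (by positivity) hr
  have h2 : ∫ x in Ioi 0, r * Real.exp (-(r * x)) * x ^ n
      = r * ∫ x in Ioi 0, x ^ ((n : ℝ) + 1 - 1) * Real.exp (-(r * x)) := by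
    rw [← integral_const_mul]
    refine setIntegral_congr_fun measurableSet_Ioi fun x _ => ?_
    simp only [add_sub_cancel_right, Real.rpow_natCast]
    ring
  rw [integral_expMeasure hr, h2, h, Real.Gamma_nat_eq_factorial]
  rw [show (n : ℝ) + 1 = ((n + 1 : ℕ) : ℝ) by push_cast; ring, Real.rpow_natCast]
  field_simp
  rw [one_div, inv_pow]
  field_simp
  ring

lemma integral_posPart_pow_expMeasure (hr : 0 < r) {k : ℕ} (hk : k ≠ 0) {v : ℝ} (hv : 0 ≤ v) :
    ∫ x, (max 0 (v - x)) ^ k ∂expMeasure r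
      = ∫ x in (0 : ℝ)..v, r * Real.exp (-(r * x)) * (v - x) ^ k := by
  rw [integral_expMeasure hr, intervalIntegral.integral_of_le hv]
  rw [setIntegral_eq_of_subset_of_forall_sdiff_eq_zero measurableSet_Ioi
    (fun x hx => hx.1 : Ioc 0 v ⊆ Ioi 0)]
  · refine setIntegral_congr_fun measurableSet_Ioc fun x hx => ?_
    rw [max_eq_right (by linarith [hx.2])]
  · rintro x ⟨hx, hx'⟩
    have : v < x := by
      by_contra h
      exact hx' ⟨hx, not_lt.1 h⟩
    rw [max_eq_left (by linarith), zero_pow hk, mul_zero]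

/-- Integration by parts for the truncated moments of `v - X`, `X` exponential. -/
lemma integral_posPart_pow_succ_expMeasure (hr : 0 < r) {k : ℕ} (hk : k ≠ 0) {v : ℝ}
    (hv : 0 ≤ v) :
    ∫ x, (max 0 (v - x)) ^ (k + 1) ∂expMeasure r
      = v ^ (k + 1) - (k + 1) / r * ∫ x, (max 0 (v - x)) ^ k ∂expMeasure r := by
  rw [integral_posPart_pow_expMeasure hr hk hv,
    integral_posPart_pow_expMeasure hr k.succ_ne_zero hv]
  -- This antiderivative vanishes at `v` and equals `-v ^ (k + 1)` at `0`, which leaves the boundary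
  -- term `v ^ (k + 1)`.
  have hder : ∀ x ∈ uIcc 0 v, HasDerivAt (fun x => -(Real.exp (-(r * x)) * (v - x) ^ (k + 1)))
      (r * Real.exp (-(r * x)) * (v - x) ^ (k + 1)
        + (k + 1) / r * (r * Real.exp (-(r * x)) * (v - x) ^ k)) x := by
    intro x _
    have h1 : HasDerivAt (fun x => Real.exp (-(r * x))) (Real.exp (-(r * x)) * -(r * 1)) x :=
      (((hasDerivAt_id x).const_mul r).neg).exp
    have h2 := ((hasDerivAt_id x).const_sub v).pow (k + 1)
    refine (h1.mul h2).neg.congr_deriv ?_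
    simp only [id, Pi.pow_apply, add_tsub_cancel_right]
    push_cast
    field_simp
    ring
  have h := intervalIntegral.integral_eq_sub_of_hasDerivAt hder
    (Continuous.intervalIntegrable (by fun_prop) _ _)
  rw [intervalIntegral.integral_add (Continuous.intervalIntegrable (by fun_prop) _ _)
    (Continuous.intervalIntegrable (by fun_prop) _ _), intervalIntegral.integral_const_mul] at h
  simp at h
  linarith

end Exponential

/-! ### Convergence of the moment recursion. -/

lemma Monotone.exists_tendsto_of_succ_le {u : ℕ → ℝ} (hu : Monotone u) {C : ℝ}
    (hC : ∀ n, u (n + 1) ≤ C) : ∃ l, Tendsto u atTop (𝓝 l) := by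
  refine ⟨_, tendsto_atTop_ciSup hu ⟨C, ?_⟩⟩
  rintro _ ⟨n, rfl⟩
  exact (hu n.le_succ).trans (hC n)

/-- Here `m`, `q`, `c` stand for the first three moments of the wait and `b`, `b₂`, `b₃` for those
of the service time. The third moments enter only through their monotonicity, which bounds `q`. -/
lemma tendsto_of_moment_recursion {m q c : ℕ → ℝ} {r b b₂ b₃ : ℝ} (hr : 0 < r) (hb : 0 ≤ b)
    (hb₂ : 0 ≤ b₂) (hstable : r * b < 1) (mm : Monotone m) (mq : Monotone q) (mc : Monotone c)
    (hq : ∀ n, q (n + 1) = q n + 2 * m n * b + b₂ - 2 / r * m (n + 1))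
    (hc : ∀ n, c (n + 1) = c n + 3 * q n * b + 3 * m n * b₂ + b₃ - 3 / r * q (n + 1)) :
    Tendsto m atTop (𝓝 (r * b₂ / (2 * (1 - r * b)))) := by
  have hpos : 0 < 1 - r * b := by linarith
  have hm_le : ∀ n, m (n + 1) ≤ r * b₂ / (2 * (1 - r * b)) := fun n => by
    have h1 := mul_le_mul_of_nonneg_right (mm n.le_succ) hb
    -- The increment of `q` is nonnegative; with `m n ≤ m (n + 1)` this can be solved for `m (n +
    -- 1)` because `r * b < 1`.
    have h2 : 0 ≤ r * (2 * m n * b + b₂ - 2 / r * m (n + 1)) :=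
      mul_nonneg hr.le (by linarith [mq n.le_succ, hq n])
    have h3 : r * (2 / r * m (n + 1)) = 2 * m (n + 1) := by field_simp
    have h4 := mul_le_mul_of_nonneg_left h1 hr.le
    rw [le_div_iff₀ (by linarith)]
    linarith
  obtain ⟨l, hl⟩ := mm.exists_tendsto_of_succ_le hm_le
  have hm_le_l : ∀ n, m n ≤ l := mm.ge_of_tendsto hl
  have hq_le : ∀ n, q (n + 1) ≤ r * (3 * l * b₂ + b₃) / (3 * (1 - r * b)) := fun n => by
    have h1 := mul_le_mul_of_nonneg_right (mq n.le_succ) hb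
    have h2 : 0 ≤ r * (3 * q n * b + 3 * m n * b₂ + b₃ - 3 / r * q (n + 1)) :=
      mul_nonneg hr.le (by linarith [mc n.le_succ, hc n])
    have h3 : r * (3 / r * q (n + 1)) = 3 * q (n + 1) := by field_simp
    have h4 := mul_le_mul_of_nonneg_left h1 hr.le
    have h5 := mul_le_mul_of_nonneg_left (mul_le_mul_of_nonneg_right (hm_le_l n) hb₂) hr.le
    rw [le_div_iff₀ (by linarith)]
    linarith
  obtain ⟨l', hl'⟩ := mq.exists_tendsto_of_succ_le hq_le
  -- The limit `l'` is finite, so it cancels and the relation determines `l`.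
  have hlim : l' = l' + 2 * l * b + b₂ - 2 / r * l := by
    refine tendsto_nhds_unique (hl'.comp (tendsto_add_atTop_nat 1)) ?_
    have h := ((hl'.add ((hl.const_mul 2).mul_const b)).add_const b₂).sub
      ((hl.comp (tendsto_add_atTop_nat 1)).const_mul (2 / r))
    exact h.congr fun n => (hq n).symm
  have : l = r * b₂ / (2 * (1 - r * b)) := by
    rw [eq_div_iff (by linarith)]
    field_simp at hlim
    linarith
  rwa [← this]

/-! ### Laws and moments of successive waits. -/

section WaitLaw

variable {r : ℝ} {μ ν : Measure ℝ}

/-- The law of `max 0 (W + S - X)` for independent `W ∼ μ`, `S ∼ ν` and `X` exponential with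
rate `r`: one step of the Lindley recursion. -/
noncomputable def waitStep (ν : Measure ℝ) (r : ℝ) (μ : Measure ℝ) : Measure ℝ :=
  ((μ.prod ν).prod (expMeasure r)).map (fun z => max 0 (z.1.1 + z.1.2 - z.2))

/-- The law of the wait of request `n` in an `M/G/1` queue that is empty at time `0`. -/
noncomputable def waitLaw (ν : Measure ℝ) (r : ℝ) : ℕ → Measure ℝ
  | 0 => Measure.dirac 0
  | n + 1 => waitStep ν r (waitLaw ν r n)

lemma measurable_lindley :
    Measurable (fun z : (ℝ × ℝ) × ℝ => max 0 (z.1.1 + z.1.2 - z.2)) := by fun_prop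

lemma ae_nonneg_waitStep (ν : Measure ℝ) (r : ℝ) (μ : Measure ℝ) :
    ∀ᵐ w ∂waitStep ν r μ, 0 ≤ w := by
  rw [waitStep, ae_map_iff measurable_lindley.aemeasurable measurableSet_Ici]
  exact ae_of_all _ fun z => le_max_left _ _

lemma ae_nonneg_waitLaw (ν : Measure ℝ) (r : ℝ) : ∀ n, ∀ᵐ w ∂waitLaw ν r n, 0 ≤ w
  | 0 => by simp [waitLaw, ae_dirac_eq]
  | n + 1 => ae_nonneg_waitStep _ _ _

lemma MeasureTheory.MemLp.integrable_pow_of_le {α : Type*} [MeasurableSpace α] {m : Measure α}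
    [IsFiniteMeasure m] {f : α → ℝ} {p : ℕ} (hf : MemLp f p m) {k : ℕ} (hk : k ≤ p) :
    Integrable (fun x => f x ^ k) m := by
  have h := (hf.mono_exponent (p := (k : ENNReal)) (by exact_mod_cast hk)).integrable_norm_pow'
  refine h.mono (hf.1.pow k) (ae_of_all _ fun x => ?_)
  simp

variable [IsProbabilityMeasure ν]

lemma isProbabilityMeasure_waitStep (hr : 0 < r) [IsProbabilityMeasure μ] :
    IsProbabilityMeasure (waitStep ν r μ) := by
  have := isProbabilityMeasure_expMeasure hr
  exact Measure.isProbabilityMeasure_map measurable_lindley.aemeasurable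

lemma isProbabilityMeasure_waitLaw (hr : 0 < r) : ∀ n, IsProbabilityMeasure (waitLaw ν r n)
  | 0 => by rw [waitLaw]; infer_instance
  | n + 1 => by
    have := isProbabilityMeasure_waitLaw hr n
    exact isProbabilityMeasure_waitStep hr

lemma memLp_lindley (hr : 0 < r) [IsProbabilityMeasure μ] {p : ℕ} (hp : p ≠ 0)
    (hμ : MemLp id p μ) (hν : MemLp id p ν) :
    MemLp (fun z : (ℝ × ℝ) × ℝ => max 0 (z.1.1 + z.1.2 - z.2)) p
      ((μ.prod ν).prod (expMeasure r)) := by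
  have := isProbabilityMeasure_expMeasure hr
  have h1 : MemLp (fun z : (ℝ × ℝ) × ℝ => z.1.1 + z.1.2 - z.2) p
      ((μ.prod ν).prod (expMeasure r)) :=
    (((hμ.comp_fst ν).add (hν.comp_snd μ)).comp_fst (expMeasure r)).sub
      ((memLp_id_expMeasure hr p hp).comp_snd (μ.prod ν))
  refine h1.mono measurable_lindley.aestronglyMeasurable (ae_of_all _ fun z => ?_)
  rw [Real.norm_eq_abs, Real.norm_eq_abs, abs_of_nonneg (le_max_left _ _)]
  exact max_le (abs_nonneg _) (le_abs_self _)

lemma memLp_id_waitLaw (hr : 0 < r) {p : ℕ} (hp : p ≠ 0) (hν : MemLp id p ν) :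
    ∀ n, MemLp id p (waitLaw ν r n)
  | 0 => by
    rw [waitLaw]
    refine memLp_of_bounded (a := 0) (b := 0) ?_ aestronglyMeasurable_id _
    simp [ae_dirac_eq]
  | n + 1 => by
    have := isProbabilityMeasure_waitLaw (ν := ν) hr n
    rw [waitLaw, waitStep, memLp_map_measure_iff aestronglyMeasurable_id
      measurable_lindley.aemeasurable]
    exact memLp_lindley hr hp (memLp_id_waitLaw hr hp hν n) hν

lemma integral_pow_waitStep (hr : 0 < r) [IsProbabilityMeasure μ] {p : ℕ} (hp : p ≠ 0)
    (hμ : MemLp id p μ) (hν : MemLp id p ν) {k : ℕ} (hk : k ≤ p) :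
    ∫ w, w ^ k ∂waitStep ν r μ
      = ∫ y, ∫ x, (max 0 (y.1 + y.2 - x)) ^ k ∂expMeasure r ∂μ.prod ν := by
  have := isProbabilityMeasure_expMeasure hr
  rw [waitStep, integral_map measurable_lindley.aemeasurable (by fun_prop),
    integral_prod _ ((memLp_lindley hr hp hμ hν).integrable_pow_of_le hk)]

/-- The moments after a Lindley step in terms of the moments before it. -/
lemma integral_pow_succ_waitStep (hr : 0 < r) [IsProbabilityMeasure μ] {k : ℕ} (hk : k ≠ 0)
    (hμ0 : ∀ᵐ w ∂μ, 0 ≤ w) (hν0 : ∀ᵐ s ∂ν, 0 ≤ s)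
    (hμ : MemLp id (k + 1 : ℕ) μ) (hν : MemLp id (k + 1 : ℕ) ν) :
    ∫ w, w ^ (k + 1) ∂waitStep ν r μ
      = ∫ y, (y.1 + y.2) ^ (k + 1) ∂μ.prod ν - (k + 1) / r * ∫ w, w ^ k ∂waitStep ν r μ := by
  have := isProbabilityMeasure_expMeasure hr
  have hadd : MemLp (fun y : ℝ × ℝ => y.1 + y.2) (k + 1 : ℕ) (μ.prod ν) :=
    (hμ.comp_fst ν).add (hν.comp_snd μ)
  rw [integral_pow_waitStep hr k.succ_ne_zero hμ hν le_rfl,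
    integral_pow_waitStep hr k.succ_ne_zero hμ hν k.le_succ, ← integral_const_mul,
    ← integral_sub (hadd.integrable_pow_of_le le_rfl)]
  · refine integral_congr_ae ?_
    have h1 : ∀ᵐ y ∂μ.prod ν, 0 ≤ y.1 := Measure.quasiMeasurePreserving_fst.ae hμ0
    have h2 : ∀ᵐ y ∂μ.prod ν, 0 ≤ y.2 := Measure.quasiMeasurePreserving_snd.ae hν0
    filter_upwards [h1, h2] with y hy1 hy2
    exact integral_posPart_pow_succ_expMeasure hr hk (add_nonneg hy1 hy2)
  · exact (((memLp_lindley hr k.succ_ne_zero hμ hν).integrable_pow_of_le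
      k.le_succ).integral_prod_left).const_mul _

lemma lintegral_waitStep (hr : 0 < r) [IsProbabilityMeasure μ] {f : ℝ → ENNReal}
    (hf : Measurable f) :
    ∫⁻ w, f w ∂waitStep ν r μ
      = ∫⁻ w, ∫⁻ s, ∫⁻ x, f (max 0 (w + s - x)) ∂expMeasure r ∂ν ∂μ := by
  have := isProbabilityMeasure_expMeasure hr
  have hm : Measurable (fun z : (ℝ × ℝ) × ℝ => f (max 0 (z.1.1 + z.1.2 - z.2))) :=
    hf.comp measurable_lindley
  rw [waitStep, lintegral_map hf measurable_lindley, lintegral_prod _ hm.aemeasurable,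
    lintegral_prod _ hm.lintegral_prod_right'.aemeasurable]

/-- The wait is stochastically increasing in the index of the request. -/
lemma lintegral_waitLaw_le_succ (hr : 0 < r) (n : ℕ) {f : ℝ → ENNReal} (hf : Monotone f) :
    ∫⁻ w, f w ∂waitLaw ν r n ≤ ∫⁻ w, f w ∂waitLaw ν r (n + 1) := by
  induction n generalizing f with
  | zero =>
    have := isProbabilityMeasure_waitLaw (ν := ν) hr 1
    rw [waitLaw, lintegral_dirac' _ hf.measurable]
    calc f 0 = ∫⁻ _, f 0 ∂waitLaw ν r 1 := by simp
      _ ≤ _ := lintegral_mono_ae ((ae_nonneg_waitLaw ν r 1).mono fun w hw => hf hw)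
  | succ n ih =>
    have := isProbabilityMeasure_waitLaw (ν := ν) hr n
    have := isProbabilityMeasure_waitLaw (ν := ν) hr (n + 1)
    rw [show waitLaw ν r (n + 1 + 1) = waitStep ν r (waitLaw ν r (n + 1)) from rfl,
      lintegral_waitStep hr hf.measurable,
      show waitLaw ν r (n + 1) = waitStep ν r (waitLaw ν r n) from rfl,
      lintegral_waitStep hr hf.measurable]
    refine ih fun w w' hw => lintegral_mono fun s => lintegral_mono fun x => hf ?_
    exact max_le_max le_rfl (by linarith)

lemma monotone_integral_pow_waitLaw (hr : 0 < r) {p : ℕ} (hp : p ≠ 0) (hν : MemLp id p ν)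
    {k : ℕ} (hk : k ≤ p) : Monotone (fun n => ∫ w, w ^ k ∂waitLaw ν r n) := by
  refine monotone_nat_of_le_succ fun n => ?_
  have hint : ∀ n, Integrable (fun w => w ^ k) (waitLaw ν r n) := fun n => by
    have := isProbabilityMeasure_waitLaw (ν := ν) hr n
    exact (memLp_id_waitLaw hr hp hν n).integrable_pow_of_le hk
  have hnn : ∀ n, 0 ≤ᵐ[waitLaw ν r n] fun w => w ^ k := fun n =>
    (ae_nonneg_waitLaw ν r n).mono fun w hw => pow_nonneg hw k
  -- Stochastic order is tested on functions monotone on all of `ℝ`, which even powers are not;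
  -- truncating at `0` repairs this without changing the integral.
  have hL : ∀ n, ∫⁻ w, ENNReal.ofReal (max 0 w ^ k) ∂waitLaw ν r n
      = ENNReal.ofReal (∫ w, w ^ k ∂waitLaw ν r n) := fun n => by
    rw [ofReal_integral_eq_lintegral_ofReal (hint n) (hnn n)]
    refine lintegral_congr_ae ((ae_nonneg_waitLaw ν r n).mono fun w hw => ?_)
    simp only [max_eq_right hw]
  rw [← ENNReal.ofReal_le_ofReal_iff (integral_nonneg_of_ae (hnn (n + 1))), ← hL, ← hL]
  refine lintegral_waitLaw_le_succ hr n fun a b hab => ENNReal.ofReal_le_ofReal ?_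
  exact pow_le_pow_left₀ (le_max_left _ _) (max_le_max le_rfl hab) k

lemma integral_add_sq_prod [IsProbabilityMeasure μ] (hμ : MemLp id (2 : ℕ) μ)
    (hν : MemLp id (2 : ℕ) ν) :
    ∫ y, (y.1 + y.2) ^ 2 ∂μ.prod ν
      = ∫ w, w ^ 2 ∂μ + 2 * (∫ w, w ∂μ) * (∫ s, s ∂ν) + ∫ s, s ^ 2 ∂ν := by
  have iμ : ∀ k ≤ 2, Integrable (fun w => w ^ k) μ := fun k hk => hμ.integrable_pow_of_le hk
  have iν : ∀ k ≤ 2, Integrable (fun w => w ^ k) ν := fun k hk => hν.integrable_pow_of_le hk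
  have h11 : Integrable (fun y : ℝ × ℝ => y.1 ^ 1 * y.2 ^ 1) (μ.prod ν) :=
    (iμ 1 (by norm_num)).mul_prod (iν 1 (by norm_num))
  have h20 := (iμ 2 le_rfl).comp_fst ν
  have h02 := (iν 2 le_rfl).comp_snd μ
  calc ∫ y, (y.1 + y.2) ^ 2 ∂μ.prod ν
      = ∫ y, (y.1 ^ 2 + 2 * (y.1 ^ 1 * y.2 ^ 1) + y.2 ^ 2) ∂μ.prod ν := by
        congr with y; ring
    _ = _ := by
      rw [integral_add (h20.fun_add (h11.const_mul 2)) h02, integral_add h20 (h11.const_mul 2),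
        integral_const_mul, integral_prod_mul (fun w => w ^ 1) (fun s => s ^ 1),
        integral_fun_fst (fun w => w ^ 2), integral_fun_snd (fun s => s ^ 2)]
      simp [mul_assoc]

lemma integral_add_cube_prod [IsProbabilityMeasure μ] (hμ : MemLp id (3 : ℕ) μ)
    (hν : MemLp id (3 : ℕ) ν) :
    ∫ y, (y.1 + y.2) ^ 3 ∂μ.prod ν
      = ∫ w, w ^ 3 ∂μ + 3 * (∫ w, w ^ 2 ∂μ) * (∫ s, s ∂ν)
        + 3 * (∫ w, w ∂μ) * (∫ s, s ^ 2 ∂ν) + ∫ s, s ^ 3 ∂ν := by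
  have iμ : ∀ k ≤ 3, Integrable (fun w => w ^ k) μ := fun k hk => hμ.integrable_pow_of_le hk
  have iν : ∀ k ≤ 3, Integrable (fun w => w ^ k) ν := fun k hk => hν.integrable_pow_of_le hk
  have h21 : Integrable (fun y : ℝ × ℝ => y.1 ^ 2 * y.2 ^ 1) (μ.prod ν) :=
    (iμ 2 (by norm_num)).mul_prod (iν 1 (by norm_num))
  have h12 : Integrable (fun y : ℝ × ℝ => y.1 ^ 1 * y.2 ^ 2) (μ.prod ν) :=
    (iμ 1 (by norm_num)).mul_prod (iν 2 (by norm_num))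
  have h30 := (iμ 3 le_rfl).comp_fst ν
  have h03 := (iν 3 le_rfl).comp_snd μ
  calc ∫ y, (y.1 + y.2) ^ 3 ∂μ.prod ν
      = ∫ y, (y.1 ^ 3 + 3 * (y.1 ^ 2 * y.2 ^ 1) + 3 * (y.1 ^ 1 * y.2 ^ 2) + y.2 ^ 3)
          ∂μ.prod ν := by
        congr with y; ring
    _ = _ := by
      rw [integral_add ((h30.fun_add (h21.const_mul 3)).fun_add (h12.const_mul 3)) h03,
        integral_add (h30.fun_add (h21.const_mul 3)) (h12.const_mul 3),
        integral_add h30 (h21.const_mul 3), integral_const_mul, integral_const_mul,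
        integral_prod_mul (fun w => w ^ 2) (fun s => s ^ 1),
        integral_prod_mul (fun w => w ^ 1) (fun s => s ^ 2),
        integral_fun_fst (fun w => w ^ 3), integral_fun_snd (fun s => s ^ 3)]
      simp [mul_assoc]

lemma integral_sq_waitLaw_succ (hr : 0 < r) (hν0 : ∀ᵐ s ∂ν, 0 ≤ s) (hν : MemLp id (2 : ℕ) ν)
    (n : ℕ) :
    ∫ w, w ^ 2 ∂waitLaw ν r (n + 1) = ∫ w, w ^ 2 ∂waitLaw ν r n
      + 2 * (∫ w, w ∂waitLaw ν r n) * (∫ s, s ∂ν) + ∫ s, s ^ 2 ∂ν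
      - 2 / r * ∫ w, w ∂waitLaw ν r (n + 1) := by
  have := isProbabilityMeasure_waitLaw (ν := ν) hr n
  have hW := memLp_id_waitLaw hr two_ne_zero hν n
  have h := integral_pow_succ_waitStep hr one_ne_zero (ae_nonneg_waitLaw ν r n) hν0 hW hν
  simp only [Nat.reduceAdd, pow_one, Nat.cast_one] at h
  rw [integral_add_sq_prod hW hν, one_add_one_eq_two] at h
  exact h

lemma integral_cube_waitLaw_succ (hr : 0 < r) (hν0 : ∀ᵐ s ∂ν, 0 ≤ s) (hν : MemLp id (3 : ℕ) ν)
    (n : ℕ) :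
    ∫ w, w ^ 3 ∂waitLaw ν r (n + 1) = ∫ w, w ^ 3 ∂waitLaw ν r n
      + 3 * (∫ w, w ^ 2 ∂waitLaw ν r n) * (∫ s, s ∂ν)
      + 3 * (∫ w, w ∂waitLaw ν r n) * (∫ s, s ^ 2 ∂ν) + ∫ s, s ^ 3 ∂ν
      - 3 / r * ∫ w, w ^ 2 ∂waitLaw ν r (n + 1) := by
  have := isProbabilityMeasure_waitLaw (ν := ν) hr n
  have hW := memLp_id_waitLaw hr three_ne_zero hν n
  have h := integral_pow_succ_waitStep hr two_ne_zero (ae_nonneg_waitLaw ν r n) hν0 hW hν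
  simp only [Nat.reduceAdd, Nat.cast_ofNat] at h
  rw [integral_add_cube_prod hW hν, two_add_one_eq_three] at h
  exact h

/-- The **Pollaczek–Khinchine formula** for the mean wait. -/
theorem tendsto_integral_waitLaw (hr : 0 < r) (hν0 : ∀ᵐ s ∂ν, 0 ≤ s)
    (hν : MemLp id (3 : ℕ) ν) (hstable : r * ∫ s, s ∂ν < 1) :
    Tendsto (fun n => ∫ w, w ∂waitLaw ν r n) atTop
      (𝓝 (r * (∫ s, s ^ 2 ∂ν) / (2 * (1 - r * ∫ s, s ∂ν)))) := by
  have hν2 : MemLp id (2 : ℕ) ν := hν.mono_exponent (by norm_num)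
  have mm : Monotone (fun n => ∫ w, w ∂waitLaw ν r n) := by
    simpa using monotone_integral_pow_waitLaw hr three_ne_zero hν (k := 1) (by norm_num)
  have mq := monotone_integral_pow_waitLaw hr three_ne_zero hν (k := 2) (by norm_num)
  have mc := monotone_integral_pow_waitLaw hr three_ne_zero hν (k := 3) le_rfl
  have hb0 : 0 ≤ ∫ s, s ∂ν := integral_nonneg_of_ae hν0
  have hq := integral_sq_waitLaw_succ hr hν0 hν2
  have hc := integral_cube_waitLaw_succ hr hν0 hν
  have hs2 : 0 ≤ ∫ s, s ^ 2 ∂ν := integral_nonneg fun s => sq_nonneg s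
  exact tendsto_of_moment_recursion hr hb0 hs2 hstable mm mq mc hq hc

end WaitLaw

/-! ### Sample paths of the queue: independence, throughput, law of the wait. -/

/-- A function of the coordinates in `S` factors through the finite tuple indexed by `S` (extended
by zero elsewhere), and disjoint finite subfamilies are independent. -/
lemma ProbabilityTheory.iIndepFun.indepFun_of_dependsOn {Ω ι β : Type*} [MeasurableSpace Ω]
    [MeasurableSpace β] {P : Measure Ω} {f : ι → Ω → ℝ} (hf : iIndepFun f P)
    (hm : ∀ i, AEMeasurable (f i) P) {S : Finset ι} {j : ι} (hj : j ∉ S) {g : (ι → ℝ) → β}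
    (hg : Measurable g) (hd : DependsOn g S) :
    IndepFun (fun ω => g (fun i => f i ω)) (f j) P := by
  classical
  have hφ : Measurable (fun (y : S → ℝ) => g (fun i => if h : i ∈ S then y ⟨i, h⟩ else 0)) := by
    refine hg.comp (measurable_pi_lambda _ fun i => ?_)
    by_cases h : i ∈ S
    · simpa [h] using measurable_pi_apply _
    · simp [h]
  have h := (hf.indepFun_finset₀ S {j} (by simpa using hj) hm).comp hφ
    (measurable_pi_apply (⟨j, by simp⟩ : ({j} : Finset ι)))
  refine (congrArg₂ (fun X Y => IndepFun X Y P) ?_ rfl).mp h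
  funext ω
  exact hd fun i hi => by simp [Finset.mem_coe.1 hi]

namespace Queue

variable {Ω : Type*} {Q : Queue Ω}

lemma wait_zero (Q : Queue Ω) (ω : Ω) : Q.wait 0 ω = 0 := by
  simp [wait, departure]

lemma departure_eq (Q : Queue Ω) (n : ℕ) (ω : Ω) :
    Q.departure n ω = Q.arrival n ω + Q.wait n ω + Q.service n ω := by
  rw [wait]; ring

/-- The **Lindley recursion**. -/
lemma wait_succ (Q : Queue Ω) (n : ℕ) (ω : Ω) :
    Q.wait (n + 1) ω = max 0 (Q.wait n ω + Q.service n ω - Q.interarrival (n + 1) ω) := by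
  have h : Q.arrival (n + 1) ω = Q.arrival n ω + Q.interarrival (n + 1) ω :=
    Finset.sum_range_succ _ _
  rw [wait, departure, add_sub_cancel_right, ← max_sub_sub_right, sub_self, departure_eq, h]
  congr 1
  ring

/-- The queue on the space of all sequences of interarrival and service times. -/
def canonical : Queue (ℕ ⊕ ℕ → ℝ) where
  interarrival n z := z (Sum.inl n)
  service n z := z (Sum.inr n)

lemma wait_eq_canonical (Q : Queue Ω) (n : ℕ) (ω : Ω) :
    Q.wait n ω = canonical.wait n (fun i => Sum.elim Q.interarrival Q.service i ω) := by
  induction n with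
  | zero => simp only [wait_zero]
  | succ n ih => rw [wait_succ, wait_succ, ih]; rfl

lemma measurable_canonical_wait (n : ℕ) : Measurable (canonical.wait n) := by
  induction n with
  | zero => simpa only [funext (wait_zero canonical)] using measurable_const
  | succ n ih =>
    rw [funext (wait_succ canonical n)]
    have h1 : Measurable (canonical.service n) := measurable_pi_apply _
    have h2 : Measurable (canonical.interarrival (n + 1)) := measurable_pi_apply _
    fun_prop

/-- The index set omits service `n` and interarrival `n + 1`, exactly the fresh inputs of the next
Lindley step. -/
lemma dependsOn_canonical_wait (n : ℕ) :
    DependsOn (canonical.wait n) ((Finset.range (n + 1)).disjSum (Finset.range n)) := by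
  induction n with
  | zero => intro x y _; simp only [wait_zero]
  | succ n ih =>
    intro x y h
    have h1 : canonical.service n x = canonical.service n y := h _ (by simp)
    have h2 : canonical.interarrival (n + 1) x = canonical.interarrival (n + 1) y :=
      h _ (by simp)
    have h3 : canonical.wait n x = canonical.wait n y := ih fun i hi => h i (by
      simp only [Finset.mem_coe] at hi ⊢
      exact Finset.disjSum_mono (by simp) (by simp) hi)
    rw [wait_succ, wait_succ, h1, h2, h3]

/-- Departures never precede arrivals. Conversely, for any slope `a > t` the arrivals lie below a
line of slope `a`, and since each service takes only `b < a`, the departures lie below the same line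
raised by `b`. -/
lemma tendsto_departure_div {ω : Ω} {b t : ℝ} (hb : 0 ≤ b) (hbt : b < t)
    (hs : ∀ n, Q.service n ω = b)
    (hA : Tendsto (fun n : ℕ => Q.arrival n ω / ((n : ℝ) + 1)) atTop (𝓝 t)) :
    Tendsto (fun n : ℕ => Q.departure n ω / ((n : ℝ) + 1)) atTop (𝓝 t) := by
  have hle : ∀ n, Q.arrival n ω ≤ Q.departure n ω := fun n => by
    cases n with
    | zero => simp [departure, hs, hb]
    | succ n => rw [departure, hs]; linarith [le_max_left (Q.arrival (n + 1) ω) (Q.departure n ω)]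
  have hn : ∀ n : ℕ, (0 : ℝ) < n + 1 := fun n => by positivity
  refine tendsto_order.2 ⟨fun u hu => ?_, fun u hu => ?_⟩
  · filter_upwards [(tendsto_order.1 hA).1 u hu] with n h
    exact h.trans_le (div_le_div_of_nonneg_right (hle n) (hn n).le)
  · obtain ⟨a, hta, hau⟩ := exists_between hu
    have hbdd : IsBoundedUnder (· ≤ ·) atTop (fun n : ℕ => Q.arrival n ω - a * (n + 1)) := by
      refine ⟨0, eventually_map.2 ?_⟩
      filter_upwards [(tendsto_order.1 hA).2 a hta] with n h
      linarith [(div_lt_iff₀ (hn n)).1 h]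
    -- The eventual bound `0` becomes a bound `C` for every `n`, as the induction starts at `0`.
    obtain ⟨C, hC⟩ := hbdd.bddAbove_range
    have hC : ∀ n : ℕ, Q.arrival n ω - a * (n + 1) ≤ C := fun n => hC ⟨n, rfl⟩
    have hD : ∀ n : ℕ, Q.departure n ω ≤ a * (n + 1) + (C + b) := fun n => by
      induction n with
      | zero =>
        have h0 := hC 0
        rw [departure, hs]
        linarith
      | succ n ih =>
        rw [departure, hs]
        have := max_le (a := Q.arrival (n + 1) ω) (b := Q.departure n ω)
          (c := a * ((n + 1 : ℕ) + 1) + C) (by linarith [hC (n + 1)])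
          (by push_cast; linarith)
        linarith
    have hlim : Tendsto (fun n : ℕ => a + (C + b) * (1 / ((n : ℝ) + 1))) atTop (𝓝 a) := by
      simpa using (tendsto_one_div_add_atTop_nhds_zero_nat (𝕜 := ℝ)).const_mul (C + b)
        |>.const_add a
    filter_upwards [(tendsto_order.1 hlim).2 u hau] with n h
    refine lt_of_le_of_lt ?_ h
    rw [div_le_iff₀ (hn n)]
    refine (hD n).trans_eq ?_
    have := (hn n).ne'
    field_simp

variable [MeasurableSpace Ω] {P : Measure Ω} {r : ℝ} {ν : Measure ℝ}

lemma IsMG1.aemeasurable (h : Q.IsMG1 P r ν) (i : ℕ ⊕ ℕ) :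
    AEMeasurable (Sum.elim Q.interarrival Q.service i) P := by
  cases i with
  | inl n => exact (h.interarrival_law n).aemeasurable
  | inr n => exact (h.service_law n).aemeasurable

lemma IsMG1.indepFun_wait_service (h : Q.IsMG1 P r ν) (n : ℕ) :
    IndepFun (Q.wait n) (Q.service n) P := by
  rw [funext (wait_eq_canonical Q n)]
  exact h.indep.indepFun_of_dependsOn h.aemeasurable (j := Sum.inr n) (by simp)
    (measurable_canonical_wait n) (dependsOn_canonical_wait n)

lemma IsMG1.indepFun_wait_service_interarrival (h : Q.IsMG1 P r ν) (n : ℕ) :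
    IndepFun (fun ω => (Q.wait n ω, Q.service n ω)) (Q.interarrival (n + 1)) P := by
  rw [funext (wait_eq_canonical Q n)]
  refine h.indep.indepFun_of_dependsOn h.aemeasurable (j := Sum.inl (n + 1))
    (S := (Finset.range (n + 1)).disjSum (Finset.range (n + 1)))
    (g := fun z => (canonical.wait n z, z (Sum.inr n))) (by simp)
    ((measurable_canonical_wait n).prodMk (measurable_pi_apply _)) fun x y hxy => ?_
  refine Prod.ext (dependsOn_canonical_wait n fun i hi => hxy i ?_) (hxy _ (by simp))
  simp only [Finset.mem_coe] at hi ⊢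
  exact Finset.disjSum_mono subset_rfl (by simp) hi

lemma IsMG1.ae_tendsto_arrival_div (h : Q.IsMG1 P r ν) (hr : 0 < r) :
    ∀ᵐ ω ∂P, Tendsto (fun n : ℕ => Q.arrival n ω / ((n : ℝ) + 1)) atTop (𝓝 (1 / r)) := by
  have hint : Integrable (Q.interarrival 0) P := by
    have := isProbabilityMeasure_expMeasure hr
    have hi := (memLp_id_expMeasure hr 1 one_ne_zero).integrable (by simp)
    rw [← (h.interarrival_law 0).map_eq] at hi
    exact hi.comp_aemeasurable (h.interarrival_law 0).aemeasurable
  have hmean : ∫ ω, Q.interarrival 0 ω ∂P = 1 / r := by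
    rw [(h.interarrival_law 0).integral_eq]
    simpa using integral_pow_expMeasure hr 1
  have hslln := strong_law_ae_real Q.interarrival hint
    (fun i j hij => h.indep.indepFun (i := Sum.inl i) (j := Sum.inl j) (by simpa using hij))
    (fun i => ⟨(h.interarrival_law i).aemeasurable, (h.interarrival_law 0).aemeasurable,
      (h.interarrival_law i).map_eq.trans (h.interarrival_law 0).map_eq.symm⟩)
  filter_upwards [hslln] with ω hω
  rw [hmean] at hω
  refine (hω.comp (tendsto_add_atTop_nat 1)).congr fun n => ?_
  -- `arrival n` has `n + 1` summands, hence the shifted index in the strong law.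
  simp [arrival]

/-- A stable `M/D/1` queue completes requests at the rate at which they arrive. -/
theorem IsMD1.hasThroughput {μ : ℝ} (h : Q.IsMD1 P r μ) (hr : 0 < r) (hμ : r < μ) :
    Q.HasThroughput P r := by
  have hs : ∀ᵐ ω ∂P, ∀ n, Q.service n ω = 1 / μ :=
    ae_all_iff.2 fun n => (h.service_law n).ae_eq_of_dirac
  filter_upwards [hs, IsMG1.ae_tendsto_arrival_div h hr] with ω hω hA
  have hD := (tendsto_departure_div (by have := hr.trans hμ; positivity)
    (one_div_lt_one_div_of_lt hr hμ) hω hA).inv₀ (by positivity)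
  simpa using hD

variable [IsProbabilityMeasure P]

lemma IsMG1.hasLaw_wait (h : Q.IsMG1 P r ν) : ∀ n, HasLaw (Q.wait n) (waitLaw ν r n) P
  | 0 => by
    rw [waitLaw, hasLaw_dirac_iff]
    exact ae_of_all _ (wait_zero Q)
  | n + 1 => by
    have h1 := (h.indepFun_wait_service n).hasLaw_prod (h.hasLaw_wait n) (h.service_law n)
    have h2 := (h.indepFun_wait_service_interarrival n).hasLaw_prod h1
      (h.interarrival_law (n + 1))
    rw [waitLaw, waitStep, funext (wait_succ Q n)]
    exact HasLaw.fun_comp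
      (Y := fun z : (ℝ × ℝ) × ℝ => max 0 (z.1.1 + z.1.2 - z.2))
      ⟨measurable_lindley.aemeasurable, rfl⟩ h2

theorem IsMG1.hasSteadyStateMean_wait (h : Q.IsMG1 P r ν) (hr : 0 < r)
    (hν0 : ∀ᵐ s ∂ν, 0 ≤ s) (hν : MemLp id (3 : ℕ) ν) (hstable : r * ∫ s, s ∂ν < 1) :
    HasSteadyStateMean P Q.wait (r * (∫ s, s ^ 2 ∂ν) / (2 * (1 - r * ∫ s, s ∂ν))) := by
  have : IsProbabilityMeasure ν := (h.service_law 0).isProbabilityMeasure_iff.1 inferInstance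
  refine ⟨fun n => ?_, ?_⟩
  · have := isProbabilityMeasure_waitLaw (ν := ν) hr n
    have hint := (memLp_id_waitLaw hr three_ne_zero hν n).integrable (by norm_num)
    rw [← (h.hasLaw_wait n).map_eq] at hint
    exact hint.comp_aemeasurable (h.hasLaw_wait n).aemeasurable
  · simp only [fun n => (h.hasLaw_wait n).integral_eq]
    exact tendsto_integral_waitLaw hr hν0 hν hstable

theorem IsMD1.hasSteadyStateMean_wait {μ : ℝ} (h : Q.IsMD1 P r μ) (hr : 0 < r) (hμ : r < μ) :
    HasSteadyStateMean P Q.wait (1 / 2 * (1 / (μ - r) - 1 / μ)) := by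
  have hμ0 : 0 < μ := hr.trans hμ
  have h0 := IsMG1.hasSteadyStateMean_wait h hr (by simp [ae_dirac_eq, hμ0.le])
    (memLp_of_bounded (a := 1 / μ) (b := 1 / μ) (by simp [ae_dirac_eq])
      aestronglyMeasurable_id _)
    (by simpa [← div_eq_mul_inv] using (div_lt_one hμ0).2 hμ)
  convert h0 using 1
  have h1 : μ - r ≠ 0 := by linarith
  have h2 : 1 - r * (1 / μ) = (μ - r) / μ := by field_simp
  simp only [integral_dirac, h2]
  field_simp
  ring

theorem IsMM1.hasSteadyStateMean_wait {μ : ℝ} (h : Q.IsMM1 P r μ) (hr : 0 < r) (hμ : r < μ) :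
    HasSteadyStateMean P Q.wait (r / (μ * (μ - r))) := by
  have hμ0 : 0 < μ := hr.trans hμ
  have hm : ∫ s, s ∂expMeasure μ = 1 / μ := by
    simpa using integral_pow_expMeasure hμ0 1
  have h0 := IsMG1.hasSteadyStateMean_wait h hr (ae_nonneg_expMeasure μ)
    (memLp_id_expMeasure hμ0 3 three_ne_zero)
    (by rw [hm]; simpa [← div_eq_mul_inv] using (div_lt_one hμ0).2 hμ)
  -- The second moment of the service time is `2 / μ ^ 2`, twice that of the deterministic case.
  convert h0 using 1
  have h1 : μ - r ≠ 0 := by linarith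
  have h2 : 1 - r * (1 / μ) = (μ - r) / μ := by field_simp
  rw [hm, integral_pow_expMeasure hμ0, h2]
  simp only [Nat.factorial_two, Nat.cast_ofNat]
  field_simp

lemma HasThroughput.unique {θ θ' : ℝ} (h : Q.HasThroughput P θ) (h' : Q.HasThroughput P θ') :
    θ = θ' := by
  obtain ⟨ω, h1, h2⟩ := (h.and h').exists
  exact tendsto_nhds_unique h1 h2

end Queue

/-! ### Linearity of steady-state means and the comparison. -/

section SteadyState

variable {Ω : Type*} [MeasurableSpace Ω] {P : Measure Ω} {X Y : ℕ → Ω → ℝ} {a b : ℝ}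

lemma HasSteadyStateMean.add (hX : HasSteadyStateMean P X a) (hY : HasSteadyStateMean P Y b) :
    HasSteadyStateMean P (fun n ω => X n ω + Y n ω) (a + b) := by
  refine ⟨fun n => (hX.1 n).add (hY.1 n), (hX.2.add hY.2).congr fun n => ?_⟩
  exact (integral_add (hX.1 n) (hY.1 n)).symm

lemma hasSteadyStateMean_const [IsProbabilityMeasure P] (c : ℝ) :
    HasSteadyStateMean P (fun _ _ => c) c :=
  ⟨fun _ => integrable_const c, by simp⟩

end SteadyState

theorem lemma1 {Ω : Type*} [MeasurableSpace Ω] (P : Measure Ω) [IsProbabilityMeasure P]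
    -- request rate, arrival rate at the edge NIC, NIC service rates
    (lam lamNetEdge muNetDev muNetEdge : ℝ)
    -- parallelism levels, accelerator service rates, service times
    (kDev kEdge muProcDev muProcEdge sDev sEdge : ℝ)
    -- payload sizes and bandwidth
    (Dreq Dres B : ℝ)
    (hlam : 0 < lam) (hkDev : 0 < kDev) (hkEdge : 0 < kEdge)
    (hsDev : 0 < sDev) (hsEdge : 0 < sEdge)
    (hDreq : 0 ≤ Dreq) (hDres : 0 ≤ Dres) (hB : 0 < B)
    -- the four stations; no assumption is made on their joint law
    (procDev netDev procEdge netEdge : Queue Ω)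
    (h_procDev : procDev.IsAccelerator P lam kDev muProcDev)
    (h_netDev : netDev.IsMM1 P lam muNetDev)
    (h_procEdge : procEdge.IsAccelerator P lam kEdge muProcEdge)
    (h_netEdge : netEdge.IsMM1 P lamNetEdge muNetEdge)
    -- a result is handed to the edge NIC only when the edge accelerator has completed a request
    (h_flow : procEdge.HasThroughput P lamNetEdge)
    -- every station is stable
    (h_procDev_stable : lam < kDev * muProcDev)
    (h_netDev_stable : lam < muNetDev)
    (h_procEdge_stable : lam < kEdge * muProcEdge)
    (h_netEdge_stable : lamNetEdge < muNetEdge) :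
    ∃ Tdev Tedge : ℝ,
      HasSteadyStateMean P (deviceLatency procDev sDev) Tdev ∧
      HasSteadyStateMean P (edgeLatency netDev procEdge netEdge sEdge Dreq Dres B) Tedge ∧
      (Tdev < Tedge ↔
        sDev - sEdge <
          lam / (muNetDev * (muNetDev - lam)) + lam / (muNetEdge * (muNetEdge - lam))
          + (Dreq + Dres) / B
          + 1 / 2 * (1 / (kEdge * muProcEdge - lam) - 1 / (kEdge * muProcEdge))
          - 1 / 2 * (1 / (kDev * muProcDev - lam) - 1 / (kDev * muProcDev))) := by
  -- An almost sure limit under a probability measure is unique, so the assumed throughput is the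
  -- arrival rate of the stable edge accelerator.
  obtain rfl : lamNetEdge = lam :=
    h_flow.unique (Queue.IsMD1.hasThroughput h_procEdge hlam h_procEdge_stable)
  have hpd := Queue.IsMD1.hasSteadyStateMean_wait h_procDev hlam h_procDev_stable
  have hnd := Queue.IsMM1.hasSteadyStateMean_wait h_netDev hlam h_netDev_stable
  have hpe := Queue.IsMD1.hasSteadyStateMean_wait h_procEdge hlam h_procEdge_stable
  have hne := Queue.IsMM1.hasSteadyStateMean_wait h_netEdge hlam h_netEdge_stable
  refine ⟨_, _, hpd.add (hasSteadyStateMean_const sDev),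
    ((((hnd.add (hasSteadyStateMean_const (Dreq / B))).add hpe).add
      (hasSteadyStateMean_const sEdge)).add hne).add (hasSteadyStateMean_const (Dres / B)), ?_⟩
  rw [add_div]
  constructor <;> intro h <;> linarith
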